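/- Let $G$ be a locally compact, $\sigma$-compact abelian topological group acting continuously and minimally (every orbit is dense) on a non-empty compact Hausdorff space $X$. Let $\pi_{max}:X\to X_{max}$ be a factor map (continuous, onto, $G$-equivariant) onto the maximal equicontinuous factor of $(X,G)$, that is, $X_{max}$ is a compact Hausdorff equicontinuous factor of $(X,G)$, and every equicontinuous factor of $(X,G)$ is a factor of $(X_{max},G)$. Put $R_{max}=\{(x,y)\in X\times X:\pi_{max}(x)=\pi_{max}(y)\}$, and let $P$ be the proximality relation: $(x,y)\in P$ iff for every entourage $U$ of the unique compatible uniformity of $X$ there is $t\in G$ with $(t\cdot x,t\cdot y)\in U$. The coincidence rank $cr\in\mathbb{N}\cup\{\infty\}$ is the supremum, over $\xi\in X_{max}$, of the cardinalities of the subsets of $\pi_{max}^{-1}(\xi)$ whose points are pairwise non-proximal. The Ellis semigroup $E(X,G)$ is the closure of $\{x\mapsto t\cdot x : t\in G\}$ in $X^X$ (product topology), with composition as product; $\pi_{max}$ induces the monoid morphism $(\pi_{max})_*:E(X,G)\to E(X_{max},G)$ determined by $(\pi_{max})_*(f)(\pi_{max}(x))=\pi_{max}(f(x))$. Let $M$ be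 a minimal left ideal of $E(X,G)$ and $p_0\in M$ an idempotent; then $\mathcal G=p_0M$ is a group with neutral element $p_0$ under the product of $E(X,G)$. Then: 1. For every $\xi_0\in X_{max}$ there is an abelian group structure on $X_{max}$ that makes it a topological group with neutral element $\xi_0$ and satisfies $t\cdot \xi=(t\cdot\xi_0)+\xi$ for all $t\in G$, $\xi\in X_{max}$, and for which $E(X_{max},G)\to X_{max}$, $f\mapsto f(\xi_0)$, is a homeomorphism and an isomorphism of groups. (This is the identification $E(X_{max},G)\cong X_{max}$.) 2. The supremum of the cardinalities of the sets of pairwise non-proximal points in $\pi_{max}^{-1}(\xi)$ is the same for all $\xi\in X_{max}$, hence equal to $cr$. 3. The restriction $(\pi_{max})_*:\mathcal G\to E(X_{max},G)\cong X_{max}$ is an isomorphism of groups if and only if $cr=1$; and $cr=1$ if and only if $P=R_{max}$. -/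

import Mathlib

open Set Topology Uniformity

universe u v

/-! ### Topological dynamical systems

A compact Hausdorff space carries exactly one uniform structure inducing its topology, so
`[UniformSpace X] [CompactSpace X] [T2Space X]` is the same thing as a compact Hausdorff space.
A dynamical system `(X, G)` is such an `X` with a jointly continuous additive action of `G`. -/

section Dynamics

variable (G : Type v) [AddCommGroup G]

/-- A factor map: a continuous surjective `G`-map. -/
structure IsFactorMap [TopologicalSpace G] {X : Type*} [TopologicalSpace X] [AddAction G X]
    {Y : Type*} [TopologicalSpace Y] [AddAction G Y] (π : X → Y) : Prop where
  continuous : Continuous π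
  surjective : Function.Surjective π
  map_vadd : ∀ (t : G) (x : X), π (t +ᵥ x) = t +ᵥ π x

/-- The system is equicontinuous: the maps `x ↦ t +ᵥ x`, `t ∈ G`, are uniformly equicontinuous. -/
def IsEquicontinuousSystem (X : Type*) [UniformSpace X] [AddAction G X] : Prop :=
  UniformEquicontinuous (fun (t : G) (x : X) => t +ᵥ x)

/-- `π : X → Y` is the factor map onto a maximal equicontinuous factor: `Y` is an equicontinuous
factor of `X`, and every equicontinuous factor of `X` is a factor of `Y`. (Factors of `X` are
quotients of `X`, so nothing is lost by taking them in the universe of `X`.) -/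
structure IsMaximalEquicontinuousFactor [TopologicalSpace G] {X : Type u} [TopologicalSpace X]
    [AddAction G X] {Y : Type u} [UniformSpace Y] [AddAction G Y] (π : X → Y) : Prop where
  isFactorMap : IsFactorMap G π
  equicontinuous : IsEquicontinuousSystem G Y
  exists_factor : ∀ (Z : Type u) [UniformSpace Z] [CompactSpace Z] [T2Space Z] [AddAction G Z]
    [ContinuousVAdd G Z], IsEquicontinuousSystem G Z →
    (∃ ρ : X → Z, IsFactorMap G ρ) → ∃ σ : Y → Z, IsFactorMap G σ

/-- `x` and `y` are proximal: for every entourage `U` some `t ∈ G` brings `(x, y)` into `U`. -/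
def Proximal {X : Type*} [UniformSpace X] [AddAction G X] (x y : X) : Prop :=
  ∀ U ∈ 𝓤 X, ∃ t : G, (t +ᵥ x, t +ᵥ y) ∈ U

/-- The proximality relation `P`. -/
def proximalRel (X : Type*) [UniformSpace X] [AddAction G X] : Set (X × X) :=
  {q | Proximal G q.1 q.2}

/-- The relation `{(x, y) | π x = π y}`; it is the equicontinuous structure relation `R_max` when
`π` is the factor map onto the maximal equicontinuous factor. -/
def fiberRel {X Y : Type*} (π : X → Y) : Set (X × X) :=
  {q | π q.1 = π q.2}

/-- The supremum of the cardinalities of the sets of pairwise non-proximal points in the fibre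
of `π` over `ξ`. -/
noncomputable def fiberCoincidenceRank {X Y : Type*} [UniformSpace X] [AddAction G X]
    (π : X → Y) (ξ : Y) : ℕ∞ :=
  ⨆ S : {S : Set X // S ⊆ π ⁻¹' {ξ} ∧ S.Pairwise fun x y => ¬ Proximal G x y}, S.1.encard

/-- The coincidence rank `cr`. -/
noncomputable def coincidenceRank {X Y : Type*} [UniformSpace X] [AddAction G X]
    (π : X → Y) : ℕ∞ :=
  ⨆ ξ : Y, fiberCoincidenceRank G π ξ

end Dynamics

/-! ### Existence of the maximal equicontinuous factor -/

section Existence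

/-- An equicontinuous factor of `X`, bundled. -/
structure EquicontinuousFactor (G : Type v) [AddCommGroup G] [TopologicalSpace G]
    (X : Type u) [TopologicalSpace X] [AddAction G X] where
  Z : Type u
  [unif : UniformSpace Z]
  [compact : CompactSpace Z]
  [t2 : T2Space Z]
  [act : AddAction G Z]
  [cont : ContinuousVAdd G Z]
  equi : IsEquicontinuousSystem G Z
  map : X → Z
  isFactorMap : IsFactorMap G map

attribute [instance] EquicontinuousFactor.unif EquicontinuousFactor.compact
  EquicontinuousFactor.t2 EquicontinuousFactor.act EquicontinuousFactor.cont

/-- A maximal equicontinuous factor always exists. -/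
theorem exists_isMaximalEquicontinuousFactor (G : Type v) [AddCommGroup G] [TopologicalSpace G]
    (X : Type u) [UniformSpace X] [CompactSpace X] [T2Space X] [AddAction G X]
    [ContinuousVAdd G X] :
    ∃ (Y : Type u) (_ : UniformSpace Y) (_ : CompactSpace Y) (_ : T2Space Y) (_ : AddAction G Y)
      (_ : ContinuousVAdd G Y) (π : X → Y), IsMaximalEquicontinuousFactor G π := by
  classical
  -- one equicontinuous factor for every equivalence relation that is the kernel of one
  let I : Type u := {r : Setoid X // ∃ F : EquicontinuousFactor G X, Setoid.ker F.map = r}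
  let F : I → EquicontinuousFactor G X := fun r => r.2.choose
  have hF : ∀ r : I, Setoid.ker (F r).map = r.1 := fun r => r.2.choose_spec
  let Φ : X → (r : I) → (F r).Z := fun x r => (F r).map x
  have hΦc : Continuous Φ := continuous_pi fun r => (F r).isFactorMap.continuous
  have hΦv : ∀ (t : G) (x : X), Φ (t +ᵥ x) = t +ᵥ Φ x := fun t x => by
    funext r; exact (F r).isFactorMap.map_vadd t x
  let A : AddAction G (Set.range Φ) :=
    { vadd := fun t y => ⟨t +ᵥ y.1, by
        obtain ⟨x, hx⟩ := y.2
        exact ⟨t +ᵥ x, by rw [hΦv, hx]⟩⟩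
      zero_vadd := fun y => Subtype.ext (zero_vadd G y.1)
      add_vadd := fun s t y => Subtype.ext (add_vadd s t y.1) }
  have hcoe : ∀ (t : G) (y : Set.range Φ), ((t +ᵥ y : Set.range Φ) : (r : I) → (F r).Z)
      = t +ᵥ (y : (r : I) → (F r).Z) := fun _ _ => rfl
  refine ⟨Set.range Φ, inferInstance, isCompact_iff_compactSpace.1 (isCompact_range hΦc),
    inferInstance, A, ⟨?_⟩, Set.rangeFactorization Φ, ⟨?_, ?_, ?_⟩, ?_, ?_⟩
  · refine Continuous.subtype_mk (f := fun p : G × Set.range Φ =>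
      p.1 +ᵥ (p.2 : (r : I) → (F r).Z)) ?_ _
    refine continuous_pi fun r => ?_
    exact continuous_fst.vadd ((continuous_apply r).comp (continuous_subtype_val.comp
      continuous_snd))
  · exact hΦc.subtype_mk _
  · exact Set.rangeFactorization_surjective
  · intro t x
    exact Subtype.ext (hΦv t x)
  · intro U hU
    rw [uniformity_subtype, Filter.mem_comap] at hU
    obtain ⟨V, hV, hVU⟩ := hU
    suffices H : ∀ᶠ xy : (Set.range Φ) × (Set.range Φ) in 𝓤 (Set.range Φ),
        ∀ t : G, (t +ᵥ xy.1.1, t +ᵥ xy.2.1) ∈ V from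
      H.mono fun xy h t => hVU (h t)
    have key : Filter.Tendsto (fun q : ((Set.range Φ) × (Set.range Φ)) × G =>
        (q.2 +ᵥ q.1.1.1, q.2 +ᵥ q.1.2.1)) (𝓤 (Set.range Φ) ×ˢ Filter.principal Set.univ)
        (𝓤 ((r : I) → (F r).Z)) := by
      rw [Pi.uniformity, Filter.tendsto_iInf]
      intro r
      rw [Filter.tendsto_comap_iff]
      intro W hW
      rw [Filter.mem_map]
      refine Filter.eventually_prod_principal_iff.2 ?_
      have h2 : UniformContinuous fun y : Set.range Φ => (y : (r : I) → (F r).Z) r :=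
        (Pi.uniformContinuous_proj _ r).comp uniformContinuous_subtype_val
      exact (h2.eventually ((F r).equi W hW)).mono fun xy h t _ => h t
    exact (Filter.eventually_prod_principal_iff.1 (key.eventually_mem hV)).mono
      fun xy h t => h t (Set.mem_univ t)
  · intro Z _ _ _ _ _ hZ ⟨ρ, hρ⟩
    let F' : EquicontinuousFactor G X := ⟨Z, hZ, ρ, hρ⟩
    let r : I := ⟨Setoid.ker ρ, F', rfl⟩
    have hr : ∀ x y, (F r).map x = (F r).map y ↔ ρ x = ρ y := fun x y => by
      have := hF r
      have h2 : (Setoid.ker (F r).map) x y ↔ (Setoid.ker ρ) x y := by rw [this]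
      exact h2
    have hs := (F r).isFactorMap.surjective
    let τ : (F r).Z → Z := fun z => ρ (Function.surjInv hs z)
    have hτ : ∀ x, τ ((F r).map x) = ρ x := fun x =>
      (hr _ _).1 (Function.surjInv_eq hs _)
    have hτc : Continuous τ := by
      have hq : IsQuotientMap (F r).map :=
        (F r).isFactorMap.continuous.isClosedMap.isQuotientMap
          (F r).isFactorMap.continuous hs
      rw [hq.continuous_iff]
      have : τ ∘ (F r).map = ρ := funext hτ
      rw [this]
      exact hρ.continuous
    refine ⟨fun y => τ (y.1 r), ⟨?_, ?_, ?_⟩⟩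
    · exact hτc.comp ((continuous_apply r).comp continuous_subtype_val)
    · intro z
      obtain ⟨x, rfl⟩ := hρ.surjective z
      exact ⟨⟨Φ x, x, rfl⟩, hτ x⟩
    · rintro t ⟨_, x, rfl⟩
      change τ (t +ᵥ (F r).map x) = t +ᵥ τ ((F r).map x)
      rw [← (F r).isFactorMap.map_vadd, hτ, hτ, hρ.map_vadd]

end Existence

/-! ### The Ellis semigroup -/

section Ellis

variable (G : Type v) [AddCommGroup G] [TopologicalSpace G]

/-- The underlying set of `E(X, G)`: the closure of the set `{x ↦ t +ᵥ x | t ∈ G}` in `X → X` with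
the product topology. -/
def ellisSet (X : Type*) [TopologicalSpace X] [AddAction G X] : Set (X → X) :=
  closure (Set.range fun (t : G) (x : X) => t +ᵥ x)

/-- The Ellis semigroup `E(X, G)`, under composition of maps (`(f * g) x = f (g x)`). -/
def ellis (X : Type*) [TopologicalSpace X] [AddAction G X] [ContinuousVAdd G X] :
    Submonoid (Function.End X) where
  carrier := ellisSet G X
  one_mem' := subset_closure (s := Set.range fun (t : G) (x : X) => t +ᵥ x)
    ⟨0, funext fun x => zero_vadd G x⟩
  mul_mem' := by
    intro f g hf hg
    have h1 : ∀ t : G, (fun x => t +ᵥ g x : X → X) ∈ ellisSet G X := by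
      intro t
      have hc : Continuous fun (h : X → X) (x : X) => t +ᵥ h x :=
        continuous_pi fun x => (continuous_apply x).const_vadd t
      refine map_mem_closure (f := fun (h : X → X) (x : X) => t +ᵥ h x) hc hg ?_
      rintro _ ⟨s, rfl⟩
      exact ⟨t + s, funext fun x => add_vadd t s x⟩
    have hc : Continuous fun (h : X → X) (x : X) => h (g x) :=
      continuous_pi fun x => continuous_apply (g x)
    have h2 := map_mem_closure (f := fun (h : X → X) (x : X) => h (g x)) hc hf
      (t := ellisSet G X) (by
        rintro _ ⟨t, rfl⟩
        exact h1 t)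
    rwa [ellisSet, closure_closure] at h2

/-- The topology of `E(X, G)` is the one induced from the product topology on `X → X`. -/
instance ellis.instTopologicalSpace (X : Type*) [TopologicalSpace X] [AddAction G X]
    [ContinuousVAdd G X] : TopologicalSpace (ellis G X) :=
  TopologicalSpace.induced (fun f => (f.1 : X → X)) Pi.topologicalSpace

variable {G}

theorem ellis_map_eq_of_eq {X : Type*} [TopologicalSpace X] [AddAction G X] [ContinuousVAdd G X]
    {Y : Type*} [TopologicalSpace Y] [T2Space Y] [AddAction G Y] {π : X → Y}
    (hπ : IsFactorMap G π) {f : X → X} (hf : f ∈ ellis G X) {x y : X} (h : π x = π y) :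
    π (f x) = π (f y) := by
  have hcl : IsClosed {f : X → X | π (f x) = π (f y)} :=
    isClosed_eq (hπ.continuous.comp (continuous_apply x)) (hπ.continuous.comp (continuous_apply y))
  have hf' : f ∈ closure (Set.range fun (t : G) (x : X) => t +ᵥ x) := hf
  refine closure_minimal ?_ hcl hf'
  rintro _ ⟨t, rfl⟩
  change π (t +ᵥ x) = π (t +ᵥ y)
  rw [hπ.map_vadd, hπ.map_vadd, h]

/-- The monoid morphism `π_* : E(X, G) → E(Y, G)` induced by a factor map `π : X → Y`; it is
determined by `π_* f (π x) = π (f x)`, see `ellisMap_apply`. -/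
noncomputable def ellisMap {X : Type*} [TopologicalSpace X] [AddAction G X] [ContinuousVAdd G X]
    {Y : Type*} [TopologicalSpace Y] [T2Space Y] [AddAction G Y] [ContinuousVAdd G Y] {π : X → Y}
    (hπ : IsFactorMap G π) : ellis G X →* ellis G Y where
  toFun f := ⟨fun y => π (f.1 (Function.surjInv hπ.surjective y)), by
    have hc : Continuous fun (h : X → X) (y : Y) => π (h (Function.surjInv hπ.surjective y)) :=
      continuous_pi fun y => hπ.continuous.comp (continuous_apply _)
    have hf : f.1 ∈ closure (Set.range fun (t : G) (x : X) => t +ᵥ x) := f.2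
    refine map_mem_closure
      (f := fun (h : X → X) (y : Y) => π (h (Function.surjInv hπ.surjective y))) hc hf ?_
    rintro _ ⟨t, rfl⟩
    exact ⟨t, funext fun y => by simp only [hπ.map_vadd, Function.surjInv_eq]⟩⟩
  map_one' := Subtype.ext (funext fun y => Function.surjInv_eq hπ.surjective y)
  map_mul' f g := Subtype.ext (funext fun _ =>
    ellis_map_eq_of_eq hπ f.2 (Function.surjInv_eq hπ.surjective _).symm)

theorem ellisMap_apply {X : Type*} [TopologicalSpace X] [AddAction G X] [ContinuousVAdd G X]
    {Y : Type*} [TopologicalSpace Y] [T2Space Y] [AddAction G Y] [ContinuousVAdd G Y] {π : X → Y}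
    (hπ : IsFactorMap G π) (f : ellis G X) (x : X) :
    (ellisMap hπ f).1 (π x) = π (f.1 x) :=
  ellis_map_eq_of_eq hπ f.2 (Function.surjInv_eq hπ.surjective _)

end Ellis

/-! ### Minimal left ideals and their groups -/

section Ideals

variable {S : Type*} [Semigroup S]

/-- A left ideal of a semigroup. -/
structure IsLeftIdeal (M : Set S) : Prop where
  nonempty : M.Nonempty
  mul_mem : ∀ (s : S), ∀ m ∈ M, s * m ∈ M

/-- A minimal left ideal: a left ideal that contains no other left ideal. -/
structure IsMinimalLeftIdeal (M : Set S) : Prop extends IsLeftIdeal M where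
  eq_of_subset : ∀ N : Set S, IsLeftIdeal N → N ⊆ M → N = M

/-- The set `pM = {p * m | m ∈ M}` for an idempotent `p` in a minimal left ideal `M`, with the
product of `S`. -/
def idealGroup {M : Set S} (hM : IsMinimalLeftIdeal M) {p : S} (_hpM : p ∈ M)
    (_hp : IsIdempotentElem p) : Subsemigroup S where
  carrier := (fun m => p * m) '' M
  mul_mem' := by
    rintro _ _ ⟨a, ha, rfl⟩ ⟨b, hb, rfl⟩
    exact ⟨a * (p * b), hM.mul_mem _ _ (hM.mul_mem _ _ hb), by simp only [mul_assoc]⟩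

theorem idealGroup_exists_inv {M : Set S} (hM : IsMinimalLeftIdeal M) {p : S} (hpM : p ∈ M)
    (hp : IsIdempotentElem p) (a : idealGroup hM hpM hp) :
    ∃ b : idealGroup hM hpM hp, (b * a : S) = p := by
  obtain ⟨_, m, hm, rfl⟩ := a
  have hN : Set.range (fun s : S => s * (p * m)) = M := by
    refine hM.eq_of_subset _ ⟨⟨_, p, rfl⟩, ?_⟩ ?_
    · rintro s _ ⟨t, rfl⟩
      exact ⟨s * t, mul_assoc _ _ _⟩
    · rintro _ ⟨t, rfl⟩
      exact hM.mul_mem _ _ (hM.mul_mem _ _ hm)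
  obtain ⟨s, hs⟩ : p ∈ Set.range (fun s : S => s * (p * m)) := hN ▸ hpM
  refine ⟨⟨p * (s * p), s * p, hM.mul_mem _ _ hpM, rfl⟩, ?_⟩
  change p * (s * p) * (p * m) = p
  have h1 : p * (p * m) = p * m := by rw [← mul_assoc, hp.eq]
  rw [mul_assoc, mul_assoc, h1, show s * (p * m) = p from hs, hp.eq]

/-- `pM` is a group with neutral element `p`. -/
noncomputable instance idealGroup.instGroup {M : Set S} (hM : IsMinimalLeftIdeal M) {p : S}
    (hpM : p ∈ M) (hp : IsIdempotentElem p) : Group (idealGroup hM hpM hp) :=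
  letI : One (idealGroup hM hpM hp) := ⟨⟨p, p, hpM, hp.eq⟩⟩
  letI : Inv (idealGroup hM hpM hp) := ⟨fun a => (idealGroup_exists_inv hM hpM hp a).choose⟩
  Group.ofLeftAxioms (fun a b c => mul_assoc a b c)
    (by
      rintro ⟨_, m, hm, rfl⟩
      refine Subtype.ext ?_
      change p * (p * m) = p * m
      rw [← mul_assoc, hp.eq])
    (fun a => Subtype.ext (idealGroup_exists_inv hM hpM hp a).choose_spec)

end Ideals

/-! Write `Y` for the equicontinuous factor. Its Ellis semigroup is a uniformly equicontinuous
family, and it is commutative because the translations are dense in it. Compactness and minimality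
make it act transitively, and a commutative transitive action is determined by its value at one
point. So evaluation at `ξ₀` is a continuous bijection of compact Hausdorff spaces, along which the
group structure moves to `Y`.

Proximality becomes algebraic: two points are proximal iff some `f` in `E(X, G)` identifies them
(`proximal_iff_exists_ellis`). Every element of `E(Y, G)` lifts to `E(X, G)`, and a lift carries
pairwise non-proximal sets injectively to such sets, so all fibres have the same rank. Elements of
`E(Y, G)` are injective, hence proximal points share a fibre, and rank one says the converse.

An idempotent `p` acts on `Y` as the identity, so `pM` already maps onto `E(Y, G)`. Two group
elements with the same image send each `x` into one fibre. If fibres consist of proximal pairs,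
these values coincide, since `p` fixes both and minimality of `M` prevents distinct points of the
image of `p` from being proximal. -/

/-! ### Generalities on the Ellis semigroup -/

section EllisBasic

variable {G : Type v} [AddCommGroup G] [TopologicalSpace G]
  {X : Type*} [TopologicalSpace X] [AddAction G X] [ContinuousVAdd G X]

/-- The translation by `t`, as an element of the Ellis semigroup. -/
def ellisOf (X : Type*) [TopologicalSpace X] [AddAction G X] [ContinuousVAdd G X] (t : G) :
    ellis G X :=
  ⟨fun x => t +ᵥ x, subset_closure (s := Set.range fun (t : G) (x : X) => t +ᵥ x) ⟨t, rfl⟩⟩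

theorem ellisOf_apply (t : G) (x : X) : (ellisOf X t).1 x = t +ᵥ x := rfl

theorem ellis_mul_apply (f g : ellis G X) (x : X) : (f * g).1 x = f.1 (g.1 x) := rfl

theorem ellis_one_apply (x : X) : (1 : ellis G X).1 x = x := rfl

/-- The coercion of the Ellis semigroup to functions. -/
def ellisCoe (f : ellis G X) : X → X := f.1

theorem ellis_ext {f g : ellis G X} (h : ∀ x, f.1 x = g.1 x) : f = g :=
  Subtype.ext (funext h)

theorem isEmbedding_ellisCoe : IsEmbedding (ellisCoe : ellis G X → X → X) :=
  ⟨⟨rfl⟩, Subtype.val_injective⟩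

theorem range_ellisCoe : Set.range (ellisCoe : ellis G X → X → X) = ellisSet G X := by
  ext f
  exact ⟨by rintro ⟨g, rfl⟩; exact g.2, fun h => ⟨⟨f, h⟩, rfl⟩⟩

theorem continuous_ellis_eval (x : X) : Continuous fun f : ellis G X => f.1 x :=
  (continuous_apply x).comp isEmbedding_ellisCoe.continuous

instance ellis.instT2Space [T2Space X] : T2Space (ellis G X) :=
  isEmbedding_ellisCoe.t2Space

instance ellis.instCompactSpace [CompactSpace X] : CompactSpace (ellis G X) := by
  have h : IsClosedEmbedding (ellisCoe : ellis G X → X → X) :=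
    ⟨isEmbedding_ellisCoe, by rw [range_ellisCoe]; exact isClosed_closure⟩
  exact h.compactSpace

theorem denseRange_ellisOf : DenseRange (ellisOf X : G → ellis G X) := by
  intro f
  rw [isEmbedding_ellisCoe.isInducing.closure_eq_preimage_closure_image, Set.mem_preimage,
    ← Set.range_comp]
  exact f.2

/-- In a minimal system the Ellis semigroup acts transitively. -/
theorem exists_ellis_apply_eq [CompactSpace X] [T2Space X] [AddAction.IsMinimal G X] (x y : X) :
    ∃ f : ellis G X, f.1 x = y := by
  have hc : IsClosed (Set.range fun f : ellis G X => f.1 x) :=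
    (isCompact_range (continuous_ellis_eval x)).isClosed
  have hd : Dense (Set.range fun f : ellis G X => f.1 x) := by
    refine (AddAction.dense_orbit G x).mono ?_
    rintro _ ⟨t, rfl⟩
    exact ⟨ellisOf X t, rfl⟩
  have h : y ∈ closure (Set.range fun f : ellis G X => f.1 x) := hd y
  rwa [hc.closure_eq] at h

/-- The image is compact, hence closed, and contains the dense set of translations. -/
theorem surjective_ellisMap [CompactSpace X] {Y : Type*} [TopologicalSpace Y]
    [T2Space Y] [AddAction G Y] [ContinuousVAdd G Y] {π : X → Y} (hπ : IsFactorMap G π) :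
    Function.Surjective (ellisMap hπ) := by
  have hcont : Continuous (ellisMap hπ) := by
    rw [isEmbedding_ellisCoe.continuous_iff]
    exact continuous_pi fun y => hπ.continuous.comp (continuous_ellis_eval _)
  have hc := (isCompact_range hcont).isClosed
  have hd : DenseRange (ellisMap hπ) := by
    refine Dense.mono ?_ (denseRange_ellisOf (G := G) (X := Y))
    rintro _ ⟨t, rfl⟩
    refine ⟨ellisOf X t, ellis_ext fun y => ?_⟩
    obtain ⟨x, rfl⟩ := hπ.surjective y
    rw [ellisMap_apply, ellisOf_apply, ellisOf_apply, hπ.map_vadd]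
  rw [← Set.range_eq_univ, ← hc.closure_eq, hd.closure_eq]

theorem IsFactorMap.isMinimal {X : Type*} [TopologicalSpace X] [AddAction G X]
    [AddAction.IsMinimal G X] {Y : Type*} [TopologicalSpace Y] [AddAction G Y] {π : X → Y} (hπ : IsFactorMap G π) :
    AddAction.IsMinimal G Y := by
  refine ⟨fun y => ?_⟩
  obtain ⟨x, rfl⟩ := hπ.surjective y
  refine (hπ.surjective.denseRange.dense_image hπ.continuous
    (AddAction.dense_orbit G x)).mono ?_
  rintro _ ⟨_, ⟨t, rfl⟩, rfl⟩
  exact ⟨t, (hπ.map_vadd t x).symm⟩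

end EllisBasic

/-! ### Equicontinuous minimal systems -/

section Equicontinuous

variable {G : Type v} [AddCommGroup G] [TopologicalSpace G]
  {Y : Type*} [UniformSpace Y] [AddAction G Y] [ContinuousVAdd G Y]

theorem IsEquicontinuousSystem.uniformEquicontinuous_ellis (hY : IsEquicontinuousSystem G Y) :
    UniformEquicontinuous (ellisCoe : ellis G Y → Y → Y) := by
  have h : Set.UniformEquicontinuous (ellisSet G Y) :=
    Set.UniformEquicontinuous.closure (uniformEquicontinuous_iff_range.1 hY)
  rw [uniformEquicontinuous_iff_range, range_ellisCoe]
  exact h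

theorem IsEquicontinuousSystem.continuous_ellis (hY : IsEquicontinuousSystem G Y)
    (f : ellis G Y) : Continuous f.1 :=
  (hY.uniformEquicontinuous_ellis.uniformContinuous f).continuous

/-- Equicontinuity controls the change of point uniformly in the map, so pointwise convergence of
the maps suffices. This yields continuity of addition on `Y`. -/
theorem IsEquicontinuousSystem.continuous_ellis_uncurry (hY : IsEquicontinuousSystem G Y) :
    Continuous fun q : ellis G Y × Y => q.1.1 q.2 := by
  rw [continuous_iff_continuousAt]
  rintro ⟨f, y⟩
  rw [ContinuousAt, Uniform.tendsto_nhds_right, Filter.tendsto_def]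
  intro U hU
  obtain ⟨V, hV, hVU⟩ := comp_mem_uniformity_sets hU
  have h1 : ∀ᶠ q : ellis G Y × Y in 𝓝 (f, y), (f.1 y, q.1.1 y) ∈ V :=
    (((continuous_ellis_eval y).comp continuous_fst).tendsto (f, y)).eventually
      (Uniform.continuousAt_iff'_right.1 continuousAt_id hV)
  have h2 : ∀ᶠ q : ellis G Y × Y in 𝓝 (f, y), ∀ g : ellis G Y, (g.1 y, g.1 q.2) ∈ V :=
    (continuous_snd.tendsto (f, y)).eventually
      (hY.uniformEquicontinuous_ellis.equicontinuous y V hV)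
  filter_upwards [h1, h2] with q hq1 hq2
  exact hVU ⟨_, hq1, hq2 q.1⟩

theorem IsEquicontinuousSystem.ellis_mul_comm [T2Space Y] (hY : IsEquicontinuousSystem G Y)
    (f g : ellis G Y) : f * g = g * f := by
  have key : ∀ (h : ellis G Y), (∀ t : G, ellisOf Y t * h = h * ellisOf Y t) →
      ∀ f, f * h = h * f := by
    intro h hh f
    refine ellis_ext fun y => ?_
    have h1 : Continuous fun f : ellis G Y => h.1 (f.1 y) :=
      (hY.continuous_ellis h).comp (continuous_ellis_eval y)
    refine congrFun ((denseRange_ellisOf (G := G) (X := Y)).equalizer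
      (continuous_ellis_eval (h.1 y)) h1 ?_) f
    funext t
    exact congrFun (congrArg Subtype.val (hh t)) y
  -- Density is used twice: `key` for a translation lets it commute with `g`, then `key` for `g`
  -- lets `g` commute with `f`.
  refine key g (fun t => (key (ellisOf Y t) (fun s => ?_) g).symm) f
  refine ellis_ext fun y => ?_
  change s +ᵥ (t +ᵥ y) = t +ᵥ (s +ᵥ y)
  rw [← add_vadd, add_comm, add_vadd]

variable [CompactSpace Y] [T2Space Y] [AddAction.IsMinimal G Y]

/-- If `f` and `g` agree at `y`, they agree at every `h y` because both commute with `h`, and these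
points exhaust `Y`. -/
theorem IsEquicontinuousSystem.ellis_eval_bijective (hY : IsEquicontinuousSystem G Y) (y : Y) :
    Function.Bijective fun f : ellis G Y => f.1 y := by
  refine ⟨fun f g hfg => ellis_ext fun z => ?_, exists_ellis_apply_eq y⟩
  obtain ⟨h, rfl⟩ := exists_ellis_apply_eq (G := G) y z
  rw [← ellis_mul_apply, ← ellis_mul_apply, hY.ellis_mul_comm f, hY.ellis_mul_comm g,
    ellis_mul_apply, ellis_mul_apply]
  exact congrArg h.1 hfg

theorem IsEquicontinuousSystem.exists_ellis_mul_eq_one [Nonempty Y]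
    (hY : IsEquicontinuousSystem G Y) (f : ellis G Y) : ∃ g : ellis G Y, g * f = 1 := by
  obtain ⟨y⟩ := ‹Nonempty Y›
  obtain ⟨g, hg⟩ := exists_ellis_apply_eq (G := G) (f.1 y) y
  exact ⟨g, (hY.ellis_eval_bijective y).1 hg⟩

theorem IsEquicontinuousSystem.ellis_injective (hY : IsEquicontinuousSystem G Y)
    (f : ellis G Y) : Function.Injective f.1 := by
  intro x y hxy
  have : Nonempty Y := ⟨x⟩
  obtain ⟨g, hg⟩ := hY.exists_ellis_mul_eq_one f
  have h : ∀ z, g.1 (f.1 z) = z := fun z => by rw [← ellis_mul_apply, hg, ellis_one_apply]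
  rw [← h x, hxy, h y]

/-- Evaluation at `y`, as a homeomorphism from the Ellis semigroup. -/
noncomputable def IsEquicontinuousSystem.ellisHomeomorph (hY : IsEquicontinuousSystem G Y)
    (y : Y) : ellis G Y ≃ₜ Y :=
  Continuous.homeoOfEquivCompactToT2
    (f := Equiv.ofBijective (fun f : ellis G Y => f.1 y) (hY.ellis_eval_bijective y))
    (continuous_ellis_eval y)

/-- The shear `(a, b) ↦ (a, a + b)` is a continuous bijection of a compact Hausdorff space, so its
inverse `(a, b) ↦ (a, -a + b)` is continuous. -/
theorem continuous_neg_of_compact {A : Type*} [AddGroup A] [TopologicalSpace A]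
    [CompactSpace A] [T2Space A] [ContinuousAdd A] : Continuous fun a : A => -a := by
  let e : A × A ≃ A × A := Equiv.prodShear (Equiv.refl A) Equiv.addLeft
  have he : Continuous e := continuous_fst.prodMk (continuous_fst.add continuous_snd)
  have h := (Continuous.homeoOfEquivCompactToT2 (f := e) he).symm.continuous
  have h2 := (continuous_snd.comp h).comp (continuous_id.prodMk (continuous_const (y := (0 : A))))
  refine h2.congr fun a => ?_
  change -a + 0 = -a
  exact add_zero _

theorem IsEquicontinuousSystem.exists_addCommGroup (hY : IsEquicontinuousSystem G Y) (ξ₀ : Y) :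
    ∃ _ : AddCommGroup Y, IsTopologicalAddGroup Y ∧ (0 : Y) = ξ₀ ∧
      (∀ (t : G) (y : Y), t +ᵥ y = (t +ᵥ ξ₀) + y) ∧
      ∃ Φ : ellis G Y ≃ₜ Y, (∀ f, Φ f = f.1 ξ₀) ∧ ∀ f g, Φ (f * g) = Φ f + Φ g := by
  have : Nonempty Y := ⟨ξ₀⟩
  let Φ := hY.ellisHomeomorph ξ₀
  have hmul : ∀ f g, Φ (f * g) = f.1 (Φ g) := fun _ _ => rfl
  have hadd : ∀ a b, (Φ.symm a).1 b = Φ (Φ.symm a * Φ.symm b) := fun a b => by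
    rw [hmul, Φ.apply_symm_apply]
  have hone : Φ.symm ξ₀ = 1 := Φ.symm_apply_eq.2 rfl
  choose inv hinv using hY.exists_ellis_mul_eq_one
  -- The sum is defined by letting `Φ.symm a` act on `b`, so that its continuity is joint continuity
  -- of evaluation; `hadd` identifies it with the product transported along `Φ`.
  let A : AddCommGroup Y :=
    letI : Add Y := ⟨fun a b => (Φ.symm a).1 b⟩
    letI : Zero Y := ⟨ξ₀⟩
    letI : Neg Y := ⟨fun a => Φ (inv (Φ.symm a))⟩
    { AddGroup.ofLeftAxioms
        (fun a b c => by
          change (Φ.symm ((Φ.symm a).1 b)).1 c = (Φ.symm a).1 ((Φ.symm b).1 c)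
          rw [hadd a b, Φ.symm_apply_apply]
          rfl)
        (fun a => by
          change (Φ.symm ξ₀).1 a = a
          rw [hone, ellis_one_apply])
        (fun a => by
          change (Φ.symm (Φ (inv (Φ.symm a)))).1 a = ξ₀
          rw [hadd, Φ.symm_apply_apply, hinv]
          rfl) with
      add_comm := fun a b => by
        change (Φ.symm a).1 b = (Φ.symm b).1 a
        rw [hadd, hadd, hY.ellis_mul_comm] }
  have hA : ∀ a b : Y, a + b = (Φ.symm a).1 b := fun _ _ => rfl
  have hc : ContinuousAdd Y :=
    ⟨hY.continuous_ellis_uncurry.comp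
      ((Φ.symm.continuous.comp continuous_fst).prodMk continuous_snd)⟩
  refine ⟨A, { continuous_neg := continuous_neg_of_compact }, rfl, fun t y => ?_, Φ,
    fun _ => rfl, fun f g => ?_⟩
  · have h : Φ.symm (t +ᵥ ξ₀) = ellisOf Y t := Φ.symm_apply_eq.2 rfl
    rw [hA, h, ellisOf_apply]
  · rw [hA, Φ.symm_apply_apply, hmul]

end Equicontinuous

/-! ### Proximality and the coincidence rank -/

section Proximality

variable {G : Type v} [AddCommGroup G] [TopologicalSpace G]
  {X : Type*} [UniformSpace X] [CompactSpace X] [T2Space X] [AddAction G X] [ContinuousVAdd G X]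

/-- The pairs `(f x, f y)` form a compact set; if it misses the diagonal, its complement is an
entourage that no translate of `(x, y)` enters. Conversely, translations near `f` bring the pair
close to the diagonal. -/
theorem proximal_iff_exists_ellis {x y : X} :
    Proximal G x y ↔ ∃ f : ellis G X, f.1 x = f.1 y := by
  have hc : Continuous fun f : ellis G X => (f.1 x, f.1 y) :=
    (continuous_ellis_eval x).prodMk (continuous_ellis_eval y)
  constructor
  · intro h
    by_contra! hne
    have hK : IsClosed (Set.range fun f : ellis G X => (f.1 x, f.1 y)) :=
      (isCompact_range hc).isClosed
    have hU : (Set.range fun f : ellis G X => (f.1 x, f.1 y))ᶜ ∈ 𝓤 X := by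
      rw [← nhdsSet_diagonal_eq_uniformity, hK.isOpen_compl.mem_nhdsSet]
      rintro ⟨a, b⟩ hab ⟨f, hf⟩
      obtain ⟨rfl, rfl⟩ := Prod.mk.inj hf
      exact hne f hab
    obtain ⟨t, ht⟩ := h _ hU
    exact ht ⟨ellisOf X t, rfl⟩
  · rintro ⟨f, hf⟩ U hU
    have hmem : (fun g : ellis G X => (g.1 x, g.1 y)) ⁻¹' U ∈ 𝓝 f := by
      refine hc.continuousAt ?_
      rw [hf]
      exact nhds_le_uniformity (f.1 y) hU
    obtain ⟨g, hg, t, rfl⟩ :=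
      mem_closure_iff_nhds.1 (denseRange_ellisOf (G := G) (X := X) f) _ hmem
    exact ⟨t, hg⟩

theorem Proximal.of_ellis {x y : X} (f : ellis G X) (h : Proximal G (f.1 x) (f.1 y)) :
    Proximal G x y := by
  obtain ⟨g, hg⟩ := proximal_iff_exists_ellis.1 h
  exact proximal_iff_exists_ellis.2 ⟨g * f, hg⟩

theorem proximal_refl (x : X) : Proximal G x x :=
  proximal_iff_exists_ellis.2 ⟨1, rfl⟩

variable {Y : Type*} [UniformSpace Y] [CompactSpace Y] [T2Space Y] [AddAction G Y]
  [ContinuousVAdd G Y] [AddAction.IsMinimal G Y] {π : X → Y}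

theorem proximalRel_subset_fiberRel (hπ : IsFactorMap G π) (hY : IsEquicontinuousSystem G Y) :
    proximalRel G X ⊆ fiberRel π := by
  rintro ⟨x, y⟩ h
  obtain ⟨f, hf⟩ := proximal_iff_exists_ellis.1 h
  refine hY.ellis_injective (ellisMap hπ f) ?_
  change (ellisMap hπ f).1 (π x) = (ellisMap hπ f).1 (π y)
  rw [ellisMap_apply, ellisMap_apply]
  exact congrArg π hf

theorem fiberCoincidenceRank_le (hπ : IsFactorMap G π) (ξ η : Y) :
    fiberCoincidenceRank G π ξ ≤ fiberCoincidenceRank G π η := by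
  refine iSup_le ?_
  rintro ⟨S, hS, hSP⟩
  -- A lift `f` of an element taking `ξ` to `η` transports `S`. A coincidence under `f`, or
  -- proximality of two images, would make points of `S` proximal.
  obtain ⟨h, hh⟩ := exists_ellis_apply_eq (G := G) ξ η
  obtain ⟨f, rfl⟩ := surjective_ellisMap hπ h
  have hinj : Set.InjOn f.1 S := fun x hx y hy hxy => by
    by_contra hne
    exact hSP hx hy hne (proximal_iff_exists_ellis.2 ⟨f, hxy⟩)
  refine hinj.encard_image.symm.le.trans (le_iSup (fun S : {S : Set X // S ⊆ π ⁻¹' {η} ∧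
    S.Pairwise fun x y => ¬ Proximal G x y} => S.1.encard) ⟨f.1 '' S, ?_, ?_⟩)
  · rintro _ ⟨x, hx, rfl⟩
    rw [Set.mem_preimage, ← ellisMap_apply hπ, show π x = ξ from hS hx, hh]
    rfl
  · rintro _ ⟨x, hx, rfl⟩ _ ⟨y, hy, rfl⟩ hne hp
    exact hSP hx hy (fun h => hne (congrArg f.1 h)) (hp.of_ellis f)

theorem fiberCoincidenceRank_eq (hπ : IsFactorMap G π) (ξ : Y) :
    fiberCoincidenceRank G π ξ = coincidenceRank G π :=
  le_antisymm (le_iSup (fiberCoincidenceRank G π) ξ)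
    (iSup_le fun η => fiberCoincidenceRank_le hπ η ξ)

theorem coincidenceRank_eq_one_iff [Nonempty X] {Y : Type*} {π : X → Y} :
    coincidenceRank G π = 1 ↔ fiberRel π ⊆ proximalRel G X := by
  constructor
  · rintro h ⟨x, y⟩ hxy
    by_contra hp
    have hne : x ≠ y := by
      rintro rfl
      exact hp (proximal_refl x)
    have hp' : ¬ Proximal G y x := by
      intro h
      obtain ⟨f, hf⟩ := proximal_iff_exists_ellis.1 h
      exact hp (proximal_iff_exists_ellis.2 ⟨f, hf.symm⟩)
    have h2 : (2 : ℕ∞) ≤ coincidenceRank G π := by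
      rw [← Set.encard_pair hne]
      refine le_trans ?_ (le_iSup (fiberCoincidenceRank G π) (π x))
      refine le_iSup (fun S : {S : Set X // S ⊆ π ⁻¹' {π x} ∧
        S.Pairwise fun x y => ¬ Proximal G x y} => S.1.encard) ⟨{x, y}, ?_, ?_⟩
      · rintro z (rfl | rfl)
        · rfl
        · exact Eq.symm hxy
      · exact Set.pairwise_pair.2 fun _ => ⟨hp, hp'⟩
    rw [h] at h2
    exact absurd h2 (by norm_num)
  · intro h
    refine le_antisymm (iSup_le fun ξ => iSup_le ?_) ?_
    · rintro ⟨S, hS, hSP⟩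
      refine Set.encard_le_one_iff.2 fun x y hx hy => ?_
      by_contra hne
      exact hSP hx hy hne (@h (x, y) ((hS hx : π x = ξ).trans (hS hy : π y = ξ).symm))
    · obtain ⟨x⟩ := ‹Nonempty X›
      rw [← Set.encard_singleton x]
      refine le_trans ?_ (le_iSup (fiberCoincidenceRank G π) (π x))
      exact le_iSup (fun S : {S : Set X // S ⊆ π ⁻¹' {π x} ∧
        S.Pairwise fun x y => ¬ Proximal G x y} => S.1.encard)
        ⟨{x}, by simp, Set.pairwise_singleton _ _⟩

end Proximality

/-! ### The group of an idempotent in a minimal left ideal -/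

section IdealGroup

/-- The left ideal `S * m` lies in `M`, hence is all of `M`. -/
theorem IsMinimalLeftIdeal.exists_mul_eq {S : Type*} [Semigroup S] {M : Set S}
    (hM : IsMinimalLeftIdeal M) {m n : S} (hm : m ∈ M) (hn : n ∈ M) : ∃ s : S, s * m = n := by
  have hN : Set.range (fun s : S => s * m) = M := by
    refine hM.eq_of_subset _ ⟨⟨_, m, rfl⟩, ?_⟩ ?_
    · rintro s _ ⟨t, rfl⟩
      exact ⟨s * t, mul_assoc _ _ _⟩
    · rintro _ ⟨t, rfl⟩
      exact hM.mul_mem _ _ hm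
  exact (hN ▸ hn : n ∈ Set.range (fun s : S => s * m))

theorem idealGroup_mul_left {S : Type*} [Semigroup S] {M : Set S} (hM : IsMinimalLeftIdeal M)
    {p : S} (hpM : p ∈ M) (hp : IsIdempotentElem p) (a : idealGroup hM hpM hp) :
    p * (a : S) = a := by
  obtain ⟨_, m, hm, rfl⟩ := a
  change p * (p * m) = p * m
  rw [← mul_assoc, hp.eq]

variable {G : Type v} [AddCommGroup G] [TopologicalSpace G]
  {X : Type*} [UniformSpace X] [CompactSpace X] [T2Space X] [AddAction G X] [ContinuousVAdd G X]
  {M : Set (ellis G X)} (hM : IsMinimalLeftIdeal M)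
  {p : ellis G X} (hpM : p ∈ M) (hp : IsIdempotentElem p)

/-- If `f` identifies the two points, then `f * p` is still in `M`, so some `g` has `g * (f * p) =
p`: on the image of `p`, `f` can be undone. -/
theorem Proximal.idempotent_apply_eq {M : Set (ellis G X)} (hM : IsMinimalLeftIdeal M)
    {p : ellis G X} (hpM : p ∈ M) {x y : X} (h : Proximal G (p.1 x) (p.1 y)) :
    p.1 x = p.1 y := by
  obtain ⟨f, hf⟩ := proximal_iff_exists_ellis.1 h
  obtain ⟨g, hg⟩ := hM.exists_mul_eq (hM.mul_mem f p hpM) hpM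
  have key : ∀ z, g.1 (f.1 (p.1 z)) = p.1 z := fun z => congrFun (congrArg Subtype.val hg) z
  rw [← key x, ← key y, hf]

theorem exists_idealGroup_apply_eq [AddAction.IsMinimal G X] (x y : X) :
    ∃ a : idealGroup hM hpM hp, (a : ellis G X).1 x = p.1 y := by
  obtain ⟨f, hf⟩ := exists_ellis_apply_eq (G := G) (p.1 x) y
  exact ⟨⟨p * (f * p), f * p, hM.mul_mem _ _ hpM, rfl⟩, congrArg p.1 hf⟩

variable {Y : Type*} [UniformSpace Y] [CompactSpace Y] [T2Space Y] [AddAction G Y]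
  [ContinuousVAdd G Y] [AddAction.IsMinimal G Y] {π : X → Y}

/-- An injective idempotent map is the identity. -/
theorem ellisMap_idempotent {X : Type*} [TopologicalSpace X] [AddAction G X] [ContinuousVAdd G X]
    {π : X → Y} {p : ellis G X} (hp : IsIdempotentElem p) (hπ : IsFactorMap G π) (hY : IsEquicontinuousSystem G Y) :
    ellisMap hπ p = 1 := by
  refine ellis_ext fun y => hY.ellis_injective (ellisMap hπ p) ?_
  rw [← ellis_mul_apply, ← map_mul, hp.eq, ellis_one_apply]

theorem surjective_ellisMap_idealGroup {X : Type*} [TopologicalSpace X] [CompactSpace X]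
    [AddAction G X] [ContinuousVAdd G X] {π : X → Y} {M : Set (ellis G X)}
    (hM : IsMinimalLeftIdeal M) {p : ellis G X} (hpM : p ∈ M) (hp : IsIdempotentElem p)
    (hπ : IsFactorMap G π) (hY : IsEquicontinuousSystem G Y) :
    Function.Surjective fun a : idealGroup hM hpM hp => ellisMap hπ a.1 := by
  intro h
  obtain ⟨f, rfl⟩ := surjective_ellisMap hπ h
  -- Sandwiching a lift between copies of `p` puts it in the group and keeps its image, as `p` maps
  -- to `1`.
  refine ⟨⟨p * (f * p), f * p, hM.mul_mem _ _ hpM, rfl⟩, ?_⟩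
  change ellisMap hπ (p * (f * p)) = _
  rw [map_mul, map_mul, ellisMap_idempotent hp hπ hY, one_mul, mul_one]

theorem injective_ellisMap_idealGroup_iff [AddAction.IsMinimal G X] (hπ : IsFactorMap G π)
    (hY : IsEquicontinuousSystem G Y) :
    Function.Injective (fun a : idealGroup hM hpM hp => ellisMap hπ a.1) ↔
      fiberRel π ⊆ proximalRel G X := by
  constructor
  · rintro hinj ⟨x, y⟩ (hxy : π x = π y)
    -- With `a x = p x` and `b x = p y`, the images of `a` and `b` agree at `π x`, hence everywhere;
    -- injectivity then gives `p x = p y`.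
    obtain ⟨a, ha⟩ := exists_idealGroup_apply_eq hM hpM hp x x
    obtain ⟨b, hb⟩ := exists_idealGroup_apply_eq hM hpM hp x y
    have hab : a = b := hinj <| (hY.ellis_eval_bijective (π x)).1 <| by
      change (ellisMap hπ a.1).1 (π x) = (ellisMap hπ b.1).1 (π x)
      rw [ellisMap_apply, ellisMap_apply, ha, hb, ← ellisMap_apply hπ, ← ellisMap_apply hπ, hxy]
    exact proximal_iff_exists_ellis.2 ⟨p, by rw [← ha, ← hb, hab]⟩
  · intro h a b hab
    refine Subtype.ext (ellis_ext fun x => ?_)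
    have hp1 : ∀ c : idealGroup hM hpM hp, p.1 (c.1.1 x) = c.1.1 x := fun c =>
      congrFun (congrArg Subtype.val (idealGroup_mul_left hM hpM hp c)) x
    have hprox : Proximal G (a.1.1 x) (b.1.1 x) := by
      refine @h (a.1.1 x, b.1.1 x) ?_
      change π (a.1.1 x) = π (b.1.1 x)
      rw [← ellisMap_apply hπ, ← ellisMap_apply hπ]
      exact congrFun (congrArg Subtype.val hab) (π x)
    -- Both values are fixed by `p`, so they lie in its image, where proximal points coincide.
    rw [← hp1 a, ← hp1 b] at hprox ⊢
    exact hprox.idempotent_apply_eq hM hpM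

end IdealGroup

theorem mainTheorem6 {G : Type v} [AddCommGroup G] [TopologicalSpace G] [IsTopologicalAddGroup G]
    [LocallyCompactSpace G] [SigmaCompactSpace G]
    {X : Type u} [UniformSpace X] [CompactSpace X] [T2Space X] [Nonempty X]
    [AddAction G X] [ContinuousVAdd G X] [AddAction.IsMinimal G X]
    {Y : Type u} [UniformSpace Y] [CompactSpace Y] [T2Space Y]
    [AddAction G Y] [ContinuousVAdd G Y]
    (π : X → Y) (hπ : IsMaximalEquicontinuousFactor G π)
    {M : Set (ellis G X)} (hM : IsMinimalLeftIdeal M)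
    {p₀ : ellis G X} (hp₀M : p₀ ∈ M) (hp₀ : IsIdempotentElem p₀) :
    -- the identification of `E(X_max, G)` with `X_max`, for any choice of the neutral element `ξ₀`
    (∀ ξ₀ : Y, ∃ _ : AddCommGroup Y, IsTopologicalAddGroup Y ∧ (0 : Y) = ξ₀ ∧
      (∀ (t : G) (y : Y), t +ᵥ y = (t +ᵥ ξ₀) + y) ∧
      ∃ Φ : ellis G Y ≃ₜ Y, (∀ f, Φ f = f.1 ξ₀) ∧ ∀ f g, Φ (f * g) = Φ f + Φ g) ∧
    -- the coincidence rank can be computed in any fibre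
    (∀ ξ : Y, fiberCoincidenceRank G π ξ = coincidenceRank G π) ∧
    -- the group isomorphism
    ((∃ e : idealGroup hM hp₀M hp₀ ≃* ellis G Y, ∀ f, e f = ellisMap hπ.isFactorMap f.1) ↔
      coincidenceRank G π = 1) ∧
    (coincidenceRank G π = 1 ↔ proximalRel G X = fiberRel π) := by
  have hf := hπ.isFactorMap
  have hY := hπ.equicontinuous
  have hmin : AddAction.IsMinimal G Y := hf.isMinimal
  refine ⟨hY.exists_addCommGroup, fiberCoincidenceRank_eq hf, ?_, ?_⟩
  · rw [coincidenceRank_eq_one_iff, ← injective_ellisMap_idealGroup_iff hM hp₀M hp₀ hf hY]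
    constructor
    · rintro ⟨e, he⟩
      convert e.injective using 1
      exact (funext he).symm
    · intro hinj
      exact ⟨MulEquiv.ofBijective
        (MulHom.mk (fun a : idealGroup hM hp₀M hp₀ => ellisMap hf a.1) fun a b =>
          map_mul (ellisMap hf) a.1 b.1)
        ⟨hinj, surjective_ellisMap_idealGroup hM hp₀M hp₀ hf hY⟩, fun _ => rfl⟩
  · rw [coincidenceRank_eq_one_iff]
    exact ⟨fun h => (proximalRel_subset_fiberRel hf hY).antisymm h, fun h => h.symm.subset⟩
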